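/- For a group $G$ and an endomorphism $\varphi$ of $G$, call $x, y \in G$ $\varphi$-conjugate if $x = z y \varphi(z)^{-1}$ for some $z \in G$; the Reidemeister number $R(\varphi) \in \mathbb{N} \cup \{\infty\}$ is the number of $\varphi$-conjugacy classes, and the Reidemeister spectrum of $G$ is $\mathrm{Spec}_R(G) = \{R(\psi) \mid \psi \in \mathrm{Aut}(G)\}$. For integers $n \ge 0$ and $1 \le e_1 \le e_2 \le \dots \le e_n$, a finite abelian $2$-group is of type $e = (e_1, \dots, e_n)$ if it is isomorphic to $\bigoplus_{i=1}^n \mathbb{Z}/2^{e_i}\mathbb{Z}$ (the trivial group has the empty type, $n = 0$). The $abc$-decomposition of $e$ is constructed as follows. (1) Each maximal constant subsequence $e_i = e_{i+1} = \dots = e_j$ of length at least $2$ forms one $a$-block. (2) Among the remaining entries, going from left to right, each pair of successive entries $e_i, e_{i+1}$ (neither already used in a block) with $e_{i+1} = e_i + 1$ forms one $b$-block. (3) Each entry that still remains forms a $c$-block on its own. Let $b(e)$ and $c(e)$ be the numbers of $b$-blocks and of $c$-blocks. Let $A$ be a finite abelian group whose Sylow $2$-subgroup is of type $e$. Then $$\mathrm{Spec}_R(A)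 = \{ d \in \mathbb{N} \mid d \text{ divides } |A| \text{ and } \nu_2(d) \ge b(e) + c(e) \},$$ where $\nu_2(d)$ is the exponent of $2$ in $d$. -/

import Mathlib

/-- The equivalence relation of `φ`-twisted conjugacy on a group `G`:
`x` and `y` are `φ`-conjugate if `x = z * y * (φ z)⁻¹` for some `z`. -/
def twistedConjSetoid {G : Type*} [Group G] (φ : G →* G) : Setoid G where
  r x y := ∃ z : G, x = z * y * (φ z)⁻¹
  iseqv :=
    { refl := fun x => ⟨1, by simp⟩
      symm := by
        rintro x y ⟨z, rfl⟩
        exact ⟨z⁻¹, by simp [mul_assoc]⟩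
      trans := by
        rintro x y w ⟨z, rfl⟩ ⟨z', rfl⟩
        exact ⟨z * z', by simp [mul_assoc]⟩ }

/-- The Reidemeister number of `φ`: the number (possibly infinite) of `φ`-twisted
conjugacy classes. -/
noncomputable def reidemeisterNumber {G : Type*} [Group G] (φ : G →* G) : ℕ∞ :=
  ENat.card (Quotient (twistedConjSetoid φ))

/-- The Reidemeister spectrum of `G`: the set of Reidemeister numbers of the automorphisms
of `G`. -/
def reidemeisterSpectrum (G : Type*) [Group G] : Set ℕ∞ :=
  {r | ∃ ψ : MulAut G, reidemeisterNumber (ψ : G ≃* G).toMonoidHom = r}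

/-- `P` is an abelian `p`-group of type `e = (e₁ ≤ e₂ ≤ ⋯ ≤ eₙ)`, all `eᵢ ≥ 1`, i.e. it is
isomorphic to `⨁ᵢ ℤ/p^(eᵢ)`. The empty tuple (`n = 0`) is the type of the trivial group. -/
def IsOfType (p : ℕ) {n : ℕ} (e : Fin n → ℕ) (P : Type*) [Group P] : Prop :=
  Monotone e ∧ (∀ i, 1 ≤ e i) ∧
    Nonempty (P ≃* Multiplicative (∀ i : Fin n, ZMod (p ^ e i)))

/-- The three kinds of blocks of an abc-decomposition. -/
inductive ABCBlock : Type
  /-- The block `(x, …, x)` of the given length (at least `2`). -/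
  | a (x length : ℕ) : ABCBlock
  /-- The block `(x, x + 1)`. -/
  | b (x : ℕ) : ABCBlock
  /-- The block `(x)`. -/
  | c (x : ℕ) : ABCBlock

/-- Given the list of maximal constant runs of a sequence, turn the runs of length at least `2`
into a-blocks; scanning the remaining one-element runs from the left, turn neighbours `x, x + 1`
into b-blocks, and whatever is left over into c-blocks. (Runs are never empty.) -/
def blocksOfRuns : List (List ℕ) → List ABCBlock
  | [] => []
  | [] :: t => blocksOfRuns t
  | (x :: _ :: r) :: t => .a x (r.length + 2) :: blocksOfRuns t
  | [x] :: [y] :: t =>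
      if y = x + 1 then .b x :: blocksOfRuns t else .c x :: blocksOfRuns ([y] :: t)
  | [x] :: t => .c x :: blocksOfRuns t

/-- The abc-decomposition of a nondecreasing tuple `e`. `List.splitBy (· == ·)` splits
a list into its maximal constant runs. -/
def abcDecomposition {n : ℕ} (e : Fin n → ℕ) : List ABCBlock :=
  blocksOfRuns ((List.ofFn e).splitBy (· == ·))

/-- `b(e)`: the number of b-blocks in the abc-decomposition of `e`. -/
def numBBlocks {n : ℕ} (e : Fin n → ℕ) : ℕ :=
  (abcDecomposition e).countP fun | .b _ => true | _ => false

/-- `c(e)`: the number of c-blocks in the abc-decomposition of `e`. -/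
def numCBlocks {n : ℕ} (e : Fin n → ℕ) : ℕ :=
  (abcDecomposition e).countP fun | .c _ => true | _ => false

/-! On a finite abelian group the twisted conjugacy classes of `φ` are the cosets of the image of `z
↦ z / φ z`, so `R(φ)` is the number of fixed points of `φ`. The question becomes which fixed-point
counts occur.

Realisation. Fixed-point counts multiply over direct products, so each block is treated separately.
On `ZMod (p ^ x)`, multiplication by `1 + p ^ k` with `k ≥ 1` has `p ^ k` fixed points. For `p` odd,
`-1` fixes only zero, so every divisor of an odd order occurs. For `p = 2`, a c-block must lose one
factor 2, explicit matrices show that an a-block loses none, and a b-block of two cyclic factors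
loses only one (`hasFixTwoPowers_zmod_sq`, `hasFixTwoPowers_zmod_cube`,
`hasFixTwoPowers_zmod_succ`).

Lower bound. Let `T` be the set of least entries of the b- and c-blocks. Each `t ∈ T` occurs once in
`e`, and `T` has no two consecutive elements. With `a i = #{t ∈ T | t < e i}` and `b i = #{t ∈ T | t
≤ e i}`, every automorphism `φ` of the 2-group makes `φ - 1` send `⨁ 2 ^ a i` into `⨁ 2 ^ b i`: the
matrix entry `(i, j)` is divisible by `2 ^ (e i - e j)`, and a diagonal entry at an exponent of
multiplicity one is odd. The second subgroup has index `2 ^ #T` in the first, so `φ - 1` has a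
kernel of at least that size (`two_pow_card_le_card_fixed`). -/

/-! ### Fixed points and Reidemeister numbers. -/

/-- Some automorphism of `G` has exactly `d` fixed points. -/
def HasFixCard (G : Type*) [AddGroup G] (d : ℕ) : Prop :=
  ∃ φ : G ≃+ G, Nat.card {x // φ x = x} = d

theorem HasFixCard.congr {G H : Type*} [AddGroup G] [AddGroup H] {d : ℕ} (h : HasFixCard G d)
    (e : G ≃+ H) : HasFixCard H d := by
  obtain ⟨φ, rfl⟩ := h
  refine ⟨(e.symm.trans φ).trans e, Nat.card_congr ?_⟩
  exact (e.toEquiv.subtypeEquiv fun x => by simp).symm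

theorem HasFixCard.prod {G H : Type*} [AddGroup G] [AddGroup H] {d d' : ℕ} (h : HasFixCard G d)
    (h' : HasFixCard H d') : HasFixCard (G × H) (d * d') := by
  obtain ⟨φ, rfl⟩ := h
  obtain ⟨ψ, rfl⟩ := h'
  refine ⟨φ.prodCongr ψ, ?_⟩
  rw [← Nat.card_prod]
  refine Nat.card_congr (Equiv.trans ?_ Equiv.subtypeProdEquivProd)
  exact Equiv.subtypeEquivRight fun x => Prod.ext_iff

theorem HasFixCard.pi {ι : Type*} [Fintype ι] {G : ι → Type*} [∀ i, AddGroup (G i)] {d : ι → ℕ}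
    (h : ∀ i, HasFixCard (G i) (d i)) : HasFixCard (∀ i, G i) (∏ i, d i) := by
  choose φ hφ using h
  refine ⟨AddEquiv.piCongrRight φ, ?_⟩
  simp_rw [← hφ]
  rw [← Nat.card_pi]
  refine Nat.card_congr (Equiv.trans ?_ Equiv.subtypePiEquivPi)
  exact Equiv.subtypeEquivRight fun x => by simp [funext_iff]

/-- For a finite commutative group, the Reidemeister number is the number of fixed points. -/
theorem reidemeisterNumber_eq_card_fixed {A : Type*} [CommGroup A] [Finite A] (φ : A →* A) :
    reidemeisterNumber φ = (Nat.card {x // φ x = x} : ℕ) := by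
  set f : A →* A := MonoidHom.id A / φ with hf
  have hker : Nat.card f.ker = Nat.card {x // φ x = x} :=
    Nat.card_congr (Equiv.subtypeEquivRight fun x => by
      rw [MonoidHom.mem_ker, hf, MonoidHom.div_apply, div_eq_one, eq_comm, MonoidHom.id_apply])
  have hquot : Nat.card (Quotient (twistedConjSetoid φ)) = Nat.card (A ⧸ f.range) := by
    refine Nat.card_congr (Quotient.congr (Equiv.refl A) fun x y => ?_)
    change (∃ z, x = z * y * (φ z)⁻¹) ↔ QuotientGroup.leftRel _ x y
    rw [QuotientGroup.leftRel_apply]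
    constructor
    · rintro ⟨z, rfl⟩
      refine ⟨z⁻¹, ?_⟩
      simp [hf, mul_comm, div_eq_mul_inv, ← mul_assoc]
    · rintro ⟨z, hz⟩
      refine ⟨z⁻¹, ?_⟩
      have : y = x * (z / φ z) := by
        rw [eq_comm, ← eq_inv_mul_iff_mul_eq, ← hz]; simp [hf]
      rw [this]
      simp [div_eq_mul_inv, mul_comm, mul_left_comm]
  -- Kernel and image of an endomorphism of a finite group have complementary orders, so the index
  -- of the image is the order of the kernel.
  have h1 := f.ker.card_mul_index
  have h2 := f.range.card_mul_index
  rw [Subgroup.index_ker] at h1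
  have h3 : f.range.index = Nat.card f.ker := by
    have : 0 < Nat.card f.range := Nat.card_pos
    rw [← h2, mul_comm] at h1
    exact (Nat.eq_of_mul_eq_mul_left this h1).symm
  have : Finite (Quotient (twistedConjSetoid φ)) := Quotient.finite _
  rw [reidemeisterNumber, ENat.card_eq_coe_natCard, hquot, ← hker, ← h3, Subgroup.index]

theorem reidemeisterSpectrum_eq {A : Type*} [CommGroup A] [Finite A] :
    reidemeisterSpectrum A = ((↑) : ℕ → ℕ∞) '' {d | HasFixCard (Additive A) d} := by
  ext r
  constructor
  · rintro ⟨ψ, rfl⟩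
    exact ⟨_, ⟨MulEquiv.toAdditive ψ, rfl⟩,
      (reidemeisterNumber_eq_card_fixed (ψ : A ≃* A).toMonoidHom).symm⟩
  · rintro ⟨_, ⟨φ, rfl⟩, rfl⟩
    exact ⟨MulEquiv.toAdditive.symm φ,
      reidemeisterNumber_eq_card_fixed (MulEquiv.toAdditive.symm φ : A ≃* A).toMonoidHom⟩

/-! ### Automorphisms of single blocks. -/

/-- For every `m` between `lo` and `hi`, some automorphism of `G` has exactly `2 ^ m` fixed
points. -/
def HasFixTwoPowers (G : Type*) [AddGroup G] (lo hi : ℕ) : Prop :=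
  ∀ m, lo ≤ m → m ≤ hi → HasFixCard G (2 ^ m)

namespace HasFixTwoPowers

theorem congr {G H : Type*} [AddGroup G] [AddGroup H] {lo hi : ℕ} (h : HasFixTwoPowers G lo hi)
    (e : G ≃+ H) : HasFixTwoPowers H lo hi := fun m h₁ h₂ => (h m h₁ h₂).congr e

theorem prod {G H : Type*} [AddGroup G] [AddGroup H] {lo hi lo' hi' : ℕ}
    (h : HasFixTwoPowers G lo hi) (h' : HasFixTwoPowers H lo' hi') (hl : lo ≤ hi)
    (hl' : lo' ≤ hi') : HasFixTwoPowers (G × H) (lo + lo') (hi + hi') := by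
  intro m h₁ h₂
  obtain ⟨a, b, ha, ha', hb, hb', rfl⟩ :
      ∃ a b, lo ≤ a ∧ a ≤ hi ∧ lo' ≤ b ∧ b ≤ hi' ∧ m = a + b := by
    -- A sum of two integer intervals is an interval: keep `b` minimal while `a` can absorb the
    -- rest, then keep `a` maximal.
    by_cases hm : m ≤ hi + lo'
    · exact ⟨m - lo', lo', by omega, by omega, by omega, by omega, by omega⟩
    · exact ⟨hi, m - hi, by omega, by omega, by omega, by omega, by omega⟩
  rw [pow_add]
  exact (h a ha ha').prod (h' b hb hb')

end HasFixTwoPowers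

/-- Multiplication by `p ^ k` on `ZMod (p ^ x)` has kernel of size `p ^ k`. -/
theorem card_pow_mul_eq_zero {p : ℕ} (hp : p.Prime) {k x : ℕ} (hk : k ≤ x) :
    Nat.card {u : ZMod (p ^ x) // (p : ZMod (p ^ x)) ^ k * u = 0} = p ^ k := by
  have : NeZero (p ^ x) := ⟨pow_ne_zero _ hp.ne_zero⟩
  set f : ZMod (p ^ x) →+ ZMod (p ^ x) := nsmulAddMonoidHom (p ^ k) with hf
  have h1 : Nat.card f.ker = Nat.card {u : ZMod (p ^ x) // (p : ZMod (p ^ x)) ^ k * u = 0} :=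
    Nat.card_congr (Equiv.subtypeEquivRight fun u => by simp [hf, AddMonoidHom.mem_ker])
  rw [← h1]
  have h2 : f.ker.index = p ^ (x - k) := by
    rw [AddSubgroup.index_ker]
    have : f.range = AddSubgroup.zmultiples ((p ^ k : ℕ) : ZMod (p ^ x)) := by
      ext y
      simp only [AddMonoidHom.mem_range, AddSubgroup.mem_zmultiples_iff]
      constructor
      · rintro ⟨z, rfl⟩
        obtain ⟨n, rfl⟩ := ZMod.intCast_surjective z
        exact ⟨n, by simp [hf, mul_comm]⟩
      · rintro ⟨n, rfl⟩
        exact ⟨n, by simp [hf, mul_comm]⟩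
    rw [this, Nat.card_zmultiples, ZMod.addOrderOf_coe _ (NeZero.ne _),
      Nat.gcd_eq_right (pow_dvd_pow p hk), Nat.pow_div hk hp.pos]
  have h3 := f.ker.card_mul_index
  rw [h2, Nat.card_zmod] at h3
  have h4 : p ^ x = p ^ k * p ^ (x - k) := by rw [← pow_add]; congr 1; omega
  exact Nat.eq_of_mul_eq_mul_right (pow_pos hp.pos _) (h3.trans h4)

/-- Multiplication by `1 + p ^ k` works: it is a unit because `p ^ k` is nilpotent for `k ≥ 1`, and
its fixed points are the elements killed by `p ^ k`. -/
theorem hasFixCard_zmod {p : ℕ} (hp : p.Prime) {k x : ℕ} (hk : 1 ≤ k) (hkx : k ≤ x) :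
    HasFixCard (ZMod (p ^ x)) (p ^ k) := by
  have hu : IsUnit (1 + (p : ZMod (p ^ x)) ^ k) := by
    refine IsNilpotent.isUnit_one_add ⟨x, ?_⟩
    rw [← pow_mul, mul_comm, pow_mul]
    have : (p : ZMod (p ^ x)) ^ x = 0 := by exact_mod_cast ZMod.natCast_self (p ^ x)
    rw [this, zero_pow (by omega)]
  refine ⟨AddAut.mulLeft hu.unit, ?_⟩
  rw [← card_pow_mul_eq_zero hp hkx]
  exact Nat.card_congr (Equiv.subtypeEquivRight fun u => by
    simp [Units.smul_def, add_mul])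

theorem hasFixCard_zmod_one {p : ℕ} (hp : p.Prime) (hp2 : p ≠ 2) (x : ℕ) :
    HasFixCard (ZMod (p ^ x)) 1 := by
  refine ⟨AddEquiv.neg _, ?_⟩
  have h2 : IsUnit ((2 : ℕ) : ZMod (p ^ x)) := by
    rw [ZMod.isUnit_iff_coprime]
    exact (Nat.coprime_primes Nat.prime_two hp).2 hp2.symm |>.pow_right x
  rw [Nat.card_eq_one_iff_unique]
  refine ⟨⟨fun ⟨u, hu⟩ ⟨v, hv⟩ => ?_⟩, ⟨⟨0, by simp⟩⟩⟩
  have key : ∀ w : ZMod (p ^ x), -w = w → w = 0 := fun w hw => by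
    have : ((2 : ℕ) : ZMod (p ^ x)) * w = 0 := by
      push_cast
      linear_combination -hw
    exact h2.mul_right_eq_zero.1 this
  simp only [AddEquiv.neg_apply] at hu hv
  simp [key u hu, key v hv]

theorem hasFixTwoPowers_zmod (x : ℕ) : HasFixTwoPowers (ZMod (2 ^ x)) 1 x :=
  fun _ h₁ h₂ => hasFixCard_zmod Nat.prime_two h₁ h₂

theorem hasFixTwoPowers_zmod_sq (x : ℕ) :
    HasFixTwoPowers (ZMod (2 ^ x) × ZMod (2 ^ x)) 0 (x + x) := by
  intro m _ hm
  by_cases h : m ≤ x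
  · let c : ZMod (2 ^ x) := (2 : ℕ) ^ m
    -- The matrix `(1 1; c 1+c)` has determinant 1, and subtracting the identity leaves `(0 1; c
    -- c)`, whose kernel is `v = 0`, `c u = 0`.
    let φ : ZMod (2 ^ x) × ZMod (2 ^ x) ≃+ ZMod (2 ^ x) × ZMod (2 ^ x) :=
      { toFun := fun w => (w.1 + w.2, c * w.1 + (1 + c) * w.2)
        invFun := fun w => ((1 + c) * w.1 - w.2, w.2 - c * w.1)
        left_inv := fun w => by ext <;> simp <;> ring
        right_inv := fun w => by ext <;> simp <;> ring
        map_add' := fun w w' => by ext <;> simp <;> ring }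
    refine ⟨φ, ?_⟩
    rw [← card_pow_mul_eq_zero Nat.prime_two h]
    refine Nat.card_congr
      { toFun := fun w => ⟨w.1.1, ?_⟩
        invFun := fun u => ⟨(u.1, 0), ?_⟩
        left_inv := ?_
        right_inv := fun u => rfl }
    · have h1 : w.1.1 + w.1.2 = w.1.1 := congrArg Prod.fst w.2
      have h2 : c * w.1.1 + (1 + c) * w.1.2 = w.1.2 := congrArg Prod.snd w.2
      change c * w.1.1 = 0
      linear_combination h2 - c * h1
    · have := u.2
      change (u.1 + 0, c * u.1 + (1 + c) * 0) = (u.1, 0)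
      change c * u.1 = 0 at this
      simp [this]
    · rintro ⟨⟨u, v⟩, hw⟩
      have h1 : u + v = u := congrArg Prod.fst hw
      have h2 : v = 0 := by simpa using h1
      simp [h2]
  · obtain ⟨k, rfl⟩ : ∃ k, m = x + k := ⟨m - x, by omega⟩
    rw [pow_add]
    refine HasFixCard.prod ?_ ?_
    · exact ⟨AddEquiv.refl _, by simp⟩
    · exact hasFixCard_zmod Nat.prime_two (by omega) (by omega)

theorem hasFixTwoPowers_zmod_cube {x : ℕ} (hx : 1 ≤ x) :
    HasFixTwoPowers (ZMod (2 ^ x) × ZMod (2 ^ x) × ZMod (2 ^ x)) 0 (x + (x + x)) := by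
  intro m _ hm
  rcases Nat.eq_zero_or_pos m with rfl | h
  -- A companion matrix of `t ^ 3 - t - 1`: this polynomial takes the unit value `-1` at `t = 1`, so
  -- only zero is fixed.
  · let φ : ZMod (2 ^ x) × ZMod (2 ^ x) × ZMod (2 ^ x) ≃+
        ZMod (2 ^ x) × ZMod (2 ^ x) × ZMod (2 ^ x) :=
      { toFun := fun w => (w.2.1, w.2.2, w.1 + w.2.1)
        invFun := fun w => (w.2.2 - w.1, w.1, w.2.1)
        left_inv := fun w => by ext <;> simp
        right_inv := fun w => by ext <;> simp
        map_add' := fun w w' => by ext <;> simp; ring }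
    refine ⟨φ, ?_⟩
    rw [pow_zero, Nat.card_eq_one_iff_unique]
    have key : ∀ w, φ w = w → w = 0 := by
      rintro ⟨u, v, w⟩ h
      have h1 : v = u := congrArg Prod.fst h
      have h2 : w = v := congrArg (fun z => z.2.1) h
      have h3 : u + v = w := congrArg (fun z => z.2.2) h
      have h4 : u = 0 := by simpa [h1, h2] using h3
      simp [h2, h1, h4]
    exact ⟨⟨fun ⟨u, hu⟩ ⟨v, hv⟩ => by simp [key u hu, key v hv]⟩, ⟨⟨0, map_zero φ⟩⟩⟩
  · exact (hasFixTwoPowers_zmod x).prod (hasFixTwoPowers_zmod_sq x) hx (Nat.zero_le _) m h hm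

/-- Treating the two cyclic factors separately gives every exponent from 2 up; only the exponent 1
needs an automorphism mixing them, built from reduction and the injective doubling map. -/
theorem hasFixTwoPowers_zmod_succ {x : ℕ} (hx : 1 ≤ x) :
    HasFixTwoPowers (ZMod (2 ^ x) × ZMod (2 ^ (x + 1))) 1 (x + (x + 1)) := by
  intro m hm hm'
  by_cases h : m = 1
  · subst h
    let red : ZMod (2 ^ (x + 1)) →+* ZMod (2 ^ x) := ZMod.castHom (pow_dvd_pow 2 (by omega)) _
    let dbl : ZMod (2 ^ x) →+ ZMod (2 ^ (x + 1)) := ZMod.lift (2 ^ x)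
      ⟨(AddMonoidHom.mulLeft 2).comp (Int.castAddHom _), by
        have : ((2 ^ (x + 1) : ℕ) : ZMod (2 ^ (x + 1))) = 0 := ZMod.natCast_self _
        push_cast at this ⊢
        simp only [AddMonoidHom.comp_apply]
        simp
        rw [← this]; ring⟩
    have dbl_int : ∀ z : ℤ, dbl z = 2 * (z : ZMod (2 ^ (x + 1))) := fun z => by
      simp [dbl, ZMod.lift_coe]
    have red_dbl : ∀ u, red (dbl u) = 2 * u := fun u => by
      obtain ⟨z, rfl⟩ := ZMod.intCast_surjective u
      simp [dbl_int, map_ofNat]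
    have dbl_red : ∀ v, dbl (red v) = 2 * v := fun v => by
      obtain ⟨z, rfl⟩ := ZMod.intCast_surjective v
      simp [dbl_int]
    have dbl_inj : Function.Injective dbl := by
      rw [injective_iff_map_eq_zero]
      intro u hu
      obtain ⟨z, rfl⟩ := ZMod.intCast_surjective u
      rw [dbl_int] at hu
      have : ((2 * z : ℤ) : ZMod (2 ^ (x + 1))) = 0 := by push_cast; exact hu
      rw [ZMod.intCast_zmod_eq_zero_iff_dvd] at this ⊢
      push_cast [pow_succ'] at this ⊢
      exact (mul_dvd_mul_iff_left two_ne_zero).1 this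
    -- Formally the matrix `(1 1; 2 3)` of determinant 1, with `red` in place of the entry 1 and
    -- `dbl` in place of the entry 2 off the diagonal. A fixed point has `red v = 0`, hence `2 v =
    -- 0`, hence `dbl u = 0` and `u = 0`.
    let φ : ZMod (2 ^ x) × ZMod (2 ^ (x + 1)) ≃+ ZMod (2 ^ x) × ZMod (2 ^ (x + 1)) :=
      { toFun := fun w => (w.1 + red w.2, dbl w.1 + 3 * w.2)
        invFun := fun w => (3 * w.1 - red w.2, w.2 - dbl w.1)
        left_inv := fun w => by
          ext
          · simp [red_dbl, map_ofNat]; ring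
          · simp [dbl_red]; ring
        right_inv := fun w => by
          have : dbl (3 * w.1) = 3 * dbl w.1 := by
            have h3 : (3 : ZMod (2 ^ x)) * w.1 = 3 • w.1 := by simp
            rw [h3, map_nsmul]; simp
          ext
          · simp [red_dbl]; ring
          · simp [dbl_red, this]; ring
        map_add' := fun w w' => by
          ext
          · simp; ring
          · simp; ring }
    refine ⟨φ, ?_⟩
    have hcard := card_pow_mul_eq_zero Nat.prime_two (show 1 ≤ x + 1 by omega)
    rw [← hcard]
    refine Nat.card_congr
      { toFun := fun w => ⟨w.1.2, ?_⟩
        invFun := fun v => ⟨(0, v.1), ?_⟩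
        left_inv := ?_
        right_inv := fun u => rfl }
    · have h1 : w.1.1 + red w.1.2 = w.1.1 := congrArg Prod.fst w.2
      have h2 : red w.1.2 = 0 := by simpa using h1
      rw [pow_one, Nat.cast_ofNat, ← dbl_red, h2, map_zero]
    · have h2 : 2 * v.1 = 0 := by simpa using v.2
      change ((0 : ZMod (2 ^ x)) + red v.1, dbl 0 + 3 * v.1) = (0, v.1)
      have h3 : red v.1 = 0 := by
        apply dbl_inj
        rw [dbl_red, h2, map_zero]
      ext
      · simp [h3]
      · simp only [map_zero]
        linear_combination h2
    · rintro ⟨⟨u, v⟩, hw⟩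
      have h1 : u + red v = u := congrArg Prod.fst hw
      have h2 : dbl u + 3 * v = v := congrArg Prod.snd hw
      have h3 : red v = 0 := by simpa using h1
      have h4 : 2 * v = 0 := by rw [← dbl_red, h3, map_zero]
      have h5 : dbl u = dbl 0 := by
        rw [map_zero]
        linear_combination h2 - h4
      have h6 := dbl_inj h5
      simp [h6]
  · exact (hasFixTwoPowers_zmod x).prod (hasFixTwoPowers_zmod (x + 1)) hx (by omega) m
      (by omega) hm'

/-! ### Assembling the blocks of an abc-decomposition. -/

/-- `HasFixTwoPowers` for the product of the groups `ZMod (2 ^ x)` with `x` in a list. -/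
def ListHasFixTwoPowers (l : List ℕ) (lo hi : ℕ) : Prop :=
  ∀ (n : ℕ) (e : Fin n → ℕ), List.ofFn e = l → HasFixTwoPowers (∀ i, ZMod (2 ^ e i)) lo hi

/-- Splitting off the first factor of a finite product of groups. -/
def Fin.consAddEquiv {n : ℕ} (G : Fin (n + 1) → Type*) [∀ i, AddGroup (G i)] :
    G 0 × (∀ i : Fin n, G i.succ) ≃+ ∀ i, G i :=
  { Fin.consEquiv G with
    map_add' := fun a b => by
      ext i
      refine Fin.cases ?_ (fun j => ?_) i <;> simp [Fin.consEquiv] }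

namespace ListHasFixTwoPowers

variable {l : List ℕ} {lo hi lo' hi' x y z : ℕ}

theorem nil : ListHasFixTwoPowers [] 0 0 := by
  intro n e h m _ hm
  obtain rfl : n = 0 := by simpa using congrArg List.length h
  obtain rfl : m = 0 := by omega
  exact ⟨AddEquiv.refl _, by simp⟩

theorem exists_of_ofFn_eq_cons {n : ℕ} {e : Fin n → ℕ} (h : List.ofFn e = x :: l) :
    ∃ (k : ℕ) (e' : Fin k → ℕ), List.ofFn e' = l ∧
      Nonempty (ZMod (2 ^ x) × (∀ i, ZMod (2 ^ e' i)) ≃+ ∀ i, ZMod (2 ^ e i)) := by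
  cases n with
  | zero => simp at h
  | succ k =>
    rw [List.ofFn_succ, List.cons.injEq] at h
    obtain ⟨rfl, h⟩ := h
    exact ⟨k, fun i => e i.succ, h, ⟨Fin.consAddEquiv fun i => ZMod (2 ^ e i)⟩⟩

theorem cons (h : HasFixTwoPowers (ZMod (2 ^ x)) lo hi) (h' : ListHasFixTwoPowers l lo' hi')
    (hl : lo ≤ hi) (hl' : lo' ≤ hi') : ListHasFixTwoPowers (x :: l) (lo + lo') (hi + hi') := by
  intro n e he
  obtain ⟨k, e', he', ⟨f⟩⟩ := exists_of_ofFn_eq_cons he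
  exact (h.prod (h' _ _ he') hl hl').congr f

theorem cons_cons (h : HasFixTwoPowers (ZMod (2 ^ x) × ZMod (2 ^ y)) lo hi)
    (h' : ListHasFixTwoPowers l lo' hi') (hl : lo ≤ hi) (hl' : lo' ≤ hi') :
    ListHasFixTwoPowers (x :: y :: l) (lo + lo') (hi + hi') := by
  intro n e he
  obtain ⟨k, e', he', ⟨f⟩⟩ := exists_of_ofFn_eq_cons he
  obtain ⟨k', e'', he'', ⟨f'⟩⟩ := exists_of_ofFn_eq_cons he'
  exact (h.prod (h' _ _ he'') hl hl').congr
    (AddEquiv.prodAssoc.trans (((AddEquiv.refl _).prodCongr f').trans f))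

theorem cons_cons_cons (h : HasFixTwoPowers (ZMod (2 ^ x) × ZMod (2 ^ y) × ZMod (2 ^ z)) lo hi)
    (h' : ListHasFixTwoPowers l lo' hi') (hl : lo ≤ hi) (hl' : lo' ≤ hi') :
    ListHasFixTwoPowers (x :: y :: z :: l) (lo + lo') (hi + hi') := by
  intro n e he
  obtain ⟨k, e', he', ⟨f⟩⟩ := exists_of_ofFn_eq_cons he
  obtain ⟨k', e'', he'', ⟨f'⟩⟩ := exists_of_ofFn_eq_cons he'
  obtain ⟨k'', e₃, he₃, ⟨f''⟩⟩ := exists_of_ofFn_eq_cons he''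
  refine (h.prod (h' _ _ he₃) hl hl').congr
    (AddEquiv.prodAssoc.trans (((AddEquiv.refl _).prodCongr ?_).trans f))
  exact AddEquiv.prodAssoc.trans (((AddEquiv.refl _).prodCongr f'').trans f')

/-- Any length at least 2 is a sum of twos and at most one three, so pairs and one triple suffice.
-/
theorem replicate_append (hx : 1 ≤ x) (h : ListHasFixTwoPowers l lo hi) (hl : lo ≤ hi) :
    ∀ k, ListHasFixTwoPowers (List.replicate (k + 2) x ++ l) lo ((k + 2) * x + hi)
  | 0 => by
    have := cons_cons (hasFixTwoPowers_zmod_sq x) h (Nat.zero_le _) hl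
    convert this using 1
    · simp [List.replicate_succ]
    · ring
    · ring
  | 1 => by
    have := cons_cons_cons (hasFixTwoPowers_zmod_cube hx) h (Nat.zero_le _) hl
    convert this using 1
    · simp [List.replicate_succ]
    · ring
    · ring
  | k + 2 => by
    have := cons_cons (hasFixTwoPowers_zmod_sq x) (replicate_append hx h hl k) (Nat.zero_le _)
      (hl.trans (Nat.le_add_left _ _))
    convert this using 1
    · simp [List.replicate_succ]
    · ring
    · ring

end ListHasFixTwoPowers

/-- The number of b-blocks and c-blocks. -/
def numBCBlocks (L : List ABCBlock) : ℕ :=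
  (L.countP fun | .b _ => true | _ => false) + L.countP fun | .c _ => true | _ => false

@[simp] theorem numBCBlocks_nil : numBCBlocks [] = 0 := rfl

@[simp] theorem numBCBlocks_cons_a (x k : ℕ) (L : List ABCBlock) :
    numBCBlocks (.a x k :: L) = numBCBlocks L := by
  simp [numBCBlocks]

@[simp] theorem numBCBlocks_cons_b (x : ℕ) (L : List ABCBlock) :
    numBCBlocks (.b x :: L) = 1 + numBCBlocks L := by
  simp [numBCBlocks]; omega

@[simp] theorem numBCBlocks_cons_c (x : ℕ) (L : List ABCBlock) :
    numBCBlocks (.c x :: L) = 1 + numBCBlocks L := by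
  simp [numBCBlocks]; omega

theorem listHasFixTwoPowers_flatten (rs : List (List ℕ)) (hpos : ∀ x ∈ rs.flatten, 1 ≤ x)
    (hconst : ∀ r ∈ rs, ∀ x ∈ r, ∀ y ∈ r, x = y) :
    numBCBlocks (blocksOfRuns rs) ≤ rs.flatten.sum ∧
      ListHasFixTwoPowers rs.flatten (numBCBlocks (blocksOfRuns rs)) rs.flatten.sum := by
  induction rs using blocksOfRuns.induct with
  | case1 => exact ⟨by simp [blocksOfRuns], by simpa [blocksOfRuns] using .nil⟩
  | case2 t ih =>
    simpa [blocksOfRuns] using ih (by simpa using hpos) (fun r hr => hconst r (by simp [hr]))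
  | case3 x y r t ih =>
    obtain ⟨h1, h2⟩ := ih (fun z hz => hpos z (by simp at hz ⊢; tauto))
      (fun r hr => hconst r (by simp [hr]))
    have hr : x :: y :: r = List.replicate (r.length + 2) x := by
      rw [List.eq_replicate_iff]
      exact ⟨by simp, fun b hb => hconst _ List.mem_cons_self b hb x List.mem_cons_self⟩
    rw [blocksOfRuns, numBCBlocks_cons_a, List.flatten_cons, hr, List.sum_append,
      List.sum_replicate, smul_eq_mul]
    exact ⟨by omega, .replicate_append (hpos x (by simp)) h2 h1 _⟩
  | case4 x t ih =>
    obtain ⟨h1, h2⟩ := ih (fun z hz => hpos z (by simp at hz ⊢; tauto))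
      (fun r hr => hconst r (by simp [hr]))
    have hx : 1 ≤ x := hpos x (by simp)
    simp only [blocksOfRuns, if_true, numBCBlocks_cons_b, List.flatten_cons, List.cons_append,
      List.nil_append, List.sum_cons]
    rw [← add_assoc x]
    exact ⟨by omega, .cons_cons (hasFixTwoPowers_zmod_succ hx) h2 (by omega) h1⟩
  | case5 x y t hxy ih =>
    obtain ⟨h1, h2⟩ := ih (fun z hz => hpos z (by simp at hz ⊢; tauto))
      (fun r hr => hconst r (List.mem_cons_of_mem _ hr))
    have hx : 1 ≤ x := hpos x (by simp)
    rw [blocksOfRuns, if_neg hxy, numBCBlocks_cons_c, List.flatten_cons, List.cons_append,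
      List.nil_append, List.sum_cons]
    exact ⟨by omega, .cons (hasFixTwoPowers_zmod x) h2 hx h1⟩
  | case6 x t hnot ih =>
    obtain ⟨h1, h2⟩ := ih (fun z hz => hpos z (by simp at hz ⊢; tauto))
      (fun r hr => hconst r (List.mem_cons_of_mem _ hr))
    have hx : 1 ≤ x := hpos x (by simp)
    rw [blocksOfRuns, numBCBlocks_cons_c, List.flatten_cons, List.cons_append,
      List.nil_append, List.sum_cons]
    · exact ⟨by omega, .cons (hasFixTwoPowers_zmod x) h2 hx h1⟩
    · exact hnot

theorem eq_of_mem_splitBy_beq {l r : List ℕ} (hr : r ∈ l.splitBy (· == ·)) :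
    ∀ x ∈ r, ∀ y ∈ r, x = y := by
  have h := List.isChain_of_mem_splitBy hr
  have h' : r.IsChain (· = ·) := h.imp fun a b hab => by simpa using hab
  rw [List.isChain_iff_pairwise] at h'
  intro x hx y hy
  by_contra hxy
  exact hxy (h'.forall (R := (· = ·)) hx hy hxy)

theorem hasFixTwoPowers_pi {n : ℕ} (e : Fin n → ℕ) (he : ∀ i, 1 ≤ e i) :
    HasFixTwoPowers (∀ i, ZMod (2 ^ e i)) (numBBlocks e + numCBlocks e) (∑ i, e i) := by
  have h := (listHasFixTwoPowers_flatten ((List.ofFn e).splitBy (· == ·))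
    (by simpa [List.forall_mem_ofFn_iff] using he)
    (fun r hr => eq_of_mem_splitBy_beq hr)).2
  rw [List.flatten_splitBy, List.sum_ofFn] at h
  exact h n e rfl

/-! ### Groups of odd order. -/

theorem exists_prod_eq_of_dvd_prod {ι : Type*} [DecidableEq ι] (s : Finset ι) (f : ι → ℕ) :
    ∀ d, d ∣ ∏ i ∈ s, f i → ∃ g : ι → ℕ, (∀ i ∈ s, g i ∣ f i) ∧ d = ∏ i ∈ s, g i := by
  induction s using Finset.induction_on with
  | empty => intro d hd; exact ⟨fun _ => 1, by simp, by simpa using hd⟩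
  | insert a s ha ih =>
    intro d hd
    rw [Finset.prod_insert ha] at hd
    obtain ⟨d₁, d₂, h₁, h₂, rfl⟩ := exists_dvd_and_dvd_of_dvd_mul hd
    obtain ⟨g, hg, rfl⟩ := ih _ h₂
    refine ⟨Function.update g a d₁, fun i hi => ?_, ?_⟩
    · rcases eq_or_ne i a with rfl | h
      · simpa using h₁
      · simpa [h] using hg i ((Finset.mem_insert.1 hi).resolve_left h)
    · rw [Finset.prod_insert ha]
      simp only [Function.update_self]
      congr 1
      refine Finset.prod_congr rfl fun i hi => ?_
      rw [Function.update_of_ne]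
      rintro rfl
      exact ha hi

theorem hasFixCard_of_odd (G : Type*) [AddCommGroup G] [Finite G] (hG : Odd (Nat.card G)) {d : ℕ}
    (hd : d ∣ Nat.card G) : HasFixCard G d := by
  classical
  obtain ⟨ι, _, p, hp, e, ⟨f⟩⟩ := AddCommGroup.equiv_directSum_zmod_of_finite G
  let f' : G ≃+ ∀ i, ZMod (p i ^ e i) := f.trans (DirectSum.addEquivProd _)
  have hcard : Nat.card G = ∏ i, p i ^ e i := by
    rw [Nat.card_congr f'.toEquiv, Nat.card_pi]
    simp
  rw [hcard] at hd
  obtain ⟨g, hg, rfl⟩ := exists_prod_eq_of_dvd_prod _ _ _ hd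
  refine HasFixCard.congr (HasFixCard.pi fun i => ?_) f'.symm
  obtain ⟨k, hk, hgk⟩ := (Nat.dvd_prime_pow (hp i)).1 (hg i (Finset.mem_univ i))
  rw [hgk]
  rcases Nat.eq_zero_or_pos k with rfl | hk0
  · rw [pow_zero]
    -- The decomposition may contain trivial factors, where `p i = 2` is not excluded.
    rcases Nat.eq_zero_or_pos (e i) with h0 | h0
    · rw [h0, pow_zero]
      exact ⟨AddEquiv.refl _, by simp⟩
    · refine hasFixCard_zmod_one (hp i) (fun h2 => ?_) _
      have : p i ∣ Nat.card G := by
        rw [hcard]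
        exact (dvd_pow_self _ h0.ne').trans
          (Finset.dvd_prod_of_mem (fun i => p i ^ e i) (Finset.mem_univ i))
      rw [h2] at this
      exact (Nat.not_even_iff_odd.2 hG) (even_iff_two_dvd.2 this)
  · exact hasFixCard_zmod (hp i) hk0 hk

/-! ### Sparse values from the b- and c-blocks. -/

/-- The least entries of the b-blocks and of the c-blocks. -/
def bcMins : List ABCBlock → List ℕ
  | [] => []
  | .a _ _ :: L => bcMins L
  | .b x :: L => x :: bcMins L
  | .c x :: L => x :: bcMins L

theorem length_bcMins (L : List ABCBlock) : (bcMins L).length = numBCBlocks L := by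
  induction L with
  | nil => rfl
  | cons B L ih => cases B <;> simp [bcMins, ih, add_comm]

/-- A b-block at `x` consumes `x + 1`, so all later least entries are larger. After a c-block at
`x`, the value `x + 1` can only be that of an a-block, which contributes no least entry. -/
theorem bcMins_blocksOfRuns (rs : List (List ℕ)) (hnil : [] ∉ rs)
    (hlt : rs.Pairwise fun r s => ∀ x ∈ r, ∀ y ∈ s, x < y)
    (hconst : ∀ r ∈ rs, ∀ x ∈ r, ∀ y ∈ r, x = y) :
    (bcMins (blocksOfRuns rs)).Nodup ∧
      (∀ x ∈ bcMins (blocksOfRuns rs), rs.flatten.count x = 1) ∧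
      ∀ x ∈ bcMins (blocksOfRuns rs), x + 1 ∉ bcMins (blocksOfRuns rs) := by
  have mem {l : List ℕ} {x : ℕ} (h : l.count x = 1) : x ∈ l :=
    List.count_pos_iff.1 (by omega)
  induction rs using blocksOfRuns.induct with
  | case1 => simp [blocksOfRuns, bcMins]
  | case2 t ih => simp at hnil
  | case3 x y r t ih =>
    rw [List.pairwise_cons] at hlt
    obtain ⟨h1, h2, h3⟩ := ih (fun h => hnil (List.mem_cons_of_mem _ h)) hlt.2
      (fun r hr => hconst r (List.mem_cons_of_mem _ hr))
    rw [blocksOfRuns, bcMins]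
    refine ⟨h1, fun z hz => ?_, h3⟩
    rw [List.flatten_cons, List.count_append, h2 z hz]
    have : z ∉ x :: y :: r := fun hz' => by
      obtain ⟨s, hs, hzs⟩ := List.mem_flatten.1 (mem (h2 z hz))
      exact lt_irrefl _ (hlt.1 s hs z hz' z hzs)
    rw [List.count_eq_zero_of_not_mem this]
  | case4 x t ih =>
    rw [List.pairwise_cons, List.pairwise_cons] at hlt
    obtain ⟨h1, h2, h3⟩ := ih (fun h => hnil (by simp [h])) hlt.2.2
      (fun r hr => hconst r (by simp [hr]))
    have hgt : ∀ z ∈ bcMins (blocksOfRuns t), x + 1 < z := fun z hz => by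
      obtain ⟨s, hs, hzs⟩ := List.mem_flatten.1 (mem (h2 z hz))
      exact hlt.2.1 s hs (x + 1) (by simp) z hzs
    have hx : x ∉ t.flatten := fun h => by
      obtain ⟨s, hs, hzs⟩ := List.mem_flatten.1 h
      have := hlt.2.1 s hs (x + 1) (by simp) x hzs
      omega
    rw [blocksOfRuns, if_pos rfl, bcMins]
    refine ⟨List.nodup_cons.2 ⟨fun h => ?_, h1⟩, fun z hz => ?_, fun z hz => ?_⟩
    · have := hgt x h; omega
    · rcases List.mem_cons.1 hz with rfl | hz
      · simp [List.count_eq_zero_of_not_mem hx]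
      · have := hgt z hz
        have h4 : x ≠ z := by omega
        have h5 : x + 1 ≠ z := by omega
        simp [h4, h5, h2 z hz]
    · rw [List.mem_cons, not_or]
      rcases List.mem_cons.1 hz with rfl | hz
      · exact ⟨by omega, fun h => lt_irrefl _ (hgt _ h)⟩
      · have := hgt z hz
        exact ⟨by omega, h3 z hz⟩
  | case5 x y t hxy ih =>
    have hlt' := hlt
    rw [List.pairwise_cons] at hlt
    obtain ⟨h1, h2, h3⟩ := ih (fun h => hnil (List.mem_cons_of_mem _ h)) hlt.2
      (fun r hr => hconst r (List.mem_cons_of_mem _ hr))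
    have hxy' : x < y := hlt.1 [y] (by simp) x (by simp) y (by simp)
    have hgt' : ∀ z ∈ ([y] :: t).flatten, x + 1 < z := fun z hz => by
      obtain ⟨s, hs, hzs⟩ := List.mem_flatten.1 hz
      rcases List.mem_cons.1 hs with rfl | hs
      · obtain rfl := List.mem_singleton.1 hzs
        omega
      · have := (List.pairwise_cons.1 hlt.2).1 s hs y (by simp) z hzs
        omega
    rw [blocksOfRuns, if_neg hxy, bcMins]
    have hgt : ∀ z ∈ bcMins (blocksOfRuns ([y] :: t)), x + 1 < z :=
      fun z hz => hgt' z (mem (h2 z hz))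
    refine ⟨List.nodup_cons.2 ⟨fun h => ?_, h1⟩, fun z hz => ?_, fun z hz => ?_⟩
    · have := hgt x h; omega
    · rw [List.flatten_cons, List.singleton_append, List.count_cons]
      rcases List.mem_cons.1 hz with rfl | hz
      · rw [List.count_eq_zero_of_not_mem fun h => by have := hgt' _ h; omega]
        simp
      · have := hgt z hz
        have h4 : x ≠ z := by omega
        simp [-List.flatten_cons, h4, h2 z hz]
    · rw [List.mem_cons, not_or]
      rcases List.mem_cons.1 hz with rfl | hz
      · exact ⟨by omega, fun h => lt_irrefl _ (hgt _ h)⟩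
      · have := hgt z hz
        exact ⟨by omega, h3 z hz⟩
  | case6 x t hnot ih =>
    rw [List.pairwise_cons] at hlt
    obtain ⟨h1, h2, h3⟩ := ih (fun h => hnil (List.mem_cons_of_mem _ h)) hlt.2
      (fun r hr => hconst r (List.mem_cons_of_mem _ hr))
    have hgt' : ∀ z ∈ t.flatten, x < z := fun z hz => by
      obtain ⟨s, hs, hzs⟩ := List.mem_flatten.1 hz
      exact hlt.1 s hs x (by simp) z hzs
    have hgt : ∀ z ∈ bcMins (blocksOfRuns t), x < z :=
      fun z hz => hgt' z (mem (h2 z hz))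
    -- The run after `[x]` is not a singleton. If `x + 1` were a least entry it would lie in that
    -- run, since later runs are larger, and so would have multiplicity at least 2.
    have hne : x + 1 ∉ bcMins (blocksOfRuns t) := fun h => by
      match t, hnot, hnil, hlt, h2, h, hconst with
      | [], _, _, _, _, h, _ => simp [blocksOfRuns, bcMins] at h
      | [] :: t, _, hnil, _, _, _, _ => simp at hnil
      | [y] :: t, hnot, _, _, _, _, _ => exact hnot y t rfl
      | (y :: z :: r) :: t, _, _, hlt, h2, h, hconst =>
        have hx : x < y := hlt.1 (y :: z :: r) (by simp) x (by simp) y (by simp)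
        have hc := h2 _ h
        obtain ⟨s, hs, hxs⟩ := List.mem_flatten.1 (mem hc)
        have hyz : z = y := hconst (y :: z :: r) (by simp) z (by simp) y (by simp)
        have hxy : x + 1 = y := by
          rcases List.mem_cons.1 hs with rfl | hs
          · exact hconst (y :: z :: r) (by simp) _ hxs _ (by simp)
          · have := (List.pairwise_cons.1 hlt.2).1 s hs y (by simp) _ hxs
            omega
        rw [hyz, hxy] at hc
        simp at hc
    have hb : blocksOfRuns ([x] :: t) = .c x :: blocksOfRuns t := by
      rw [blocksOfRuns]
      exact hnot
    rw [hb, bcMins]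
    refine ⟨List.nodup_cons.2 ⟨fun h => ?_, h1⟩, fun z hz => ?_, fun z hz => ?_⟩
    · have := hgt x h; omega
    · rw [List.flatten_cons, List.singleton_append, List.count_cons]
      rcases List.mem_cons.1 hz with rfl | hz
      · rw [List.count_eq_zero_of_not_mem fun h => by have := hgt' _ h; omega]
        simp
      · have := hgt z hz
        have h4 : x ≠ z := by omega
        simp [h4, h2 z hz]
    · rw [List.mem_cons, not_or]
      rcases List.mem_cons.1 hz with rfl | hz
      · exact ⟨by omega, hne⟩
      · have := hgt z hz
        exact ⟨by omega, h3 z hz⟩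

theorem pairwise_lt_splitBy {l : List ℕ} (hl : l.Pairwise (· ≤ ·)) :
    (l.splitBy (· == ·)).Pairwise fun r s => ∀ x ∈ r, ∀ y ∈ s, x < y := by
  have hle : (l.splitBy (· == ·)).Pairwise fun r s => ∀ x ∈ r, ∀ y ∈ s, x ≤ y := by
    rw [← List.flatten_splitBy (· == ·) l, List.pairwise_flatten] at hl
    exact hl.2
  have hconst : ∀ r ∈ l.splitBy (· == ·), ∀ x ∈ r, ∀ y ∈ r, x = y :=
    fun r hr => eq_of_mem_splitBy_beq hr
  have hchain := List.isChain_getLast_head_splitBy (· == ·) l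
  generalize l.splitBy (· == ·) = rs at *
  induction rs with
  | nil => exact List.Pairwise.nil
  | cons r rs ih =>
    have hlt := ih (List.pairwise_cons.1 hle).2 (fun s hs => hconst s (List.mem_cons_of_mem _ hs))
      (List.isChain_cons.1 hchain).2
    refine List.pairwise_cons.2 ⟨?_, hlt⟩
    cases rs with
    | nil => simp
    | cons s rs =>
      obtain ⟨hr, hs, h⟩ := (List.isChain_cons_cons.1 hchain).1
      have key : ∀ x ∈ r, ∀ y ∈ s, x < y := fun x hx y hy => by
        refine lt_of_le_of_ne ((List.pairwise_cons.1 hle).1 s (by simp) x hx y hy) ?_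
        rw [hconst r (by simp) x hx _ (List.getLast_mem hr),
          hconst s (by simp) y hy _ (List.head_mem hs)]
        simpa using h
      intro u hu x hx y hy
      rcases List.mem_cons.1 hu with rfl | hu
      · exact key x hx y hy
      · exact (key x hx _ (List.head_mem hs)).trans
          ((List.pairwise_cons.1 hlt).1 u hu _ (List.head_mem hs) y hy)

/-- The values of multiplicity one and pairwise at distance at least two given by the least
entries of the b-blocks and of the c-blocks. -/
theorem exists_sparse_values {n : ℕ} (e : Fin n → ℕ) (he : Monotone e) :
    ∃ T : Finset ℕ, T.card = numBBlocks e + numCBlocks e ∧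
      (∀ t ∈ T, ∃! i, e i = t) ∧ ∀ t ∈ T, t + 1 ∉ T := by
  obtain ⟨h1, h2, h3⟩ := bcMins_blocksOfRuns ((List.ofFn e).splitBy (· == ·))
    (List.nil_notMem_splitBy _ _) (pairwise_lt_splitBy (List.pairwise_ofFn.2 fun i j h => he h.le))
    (fun r hr => eq_of_mem_splitBy_beq hr)
  rw [List.flatten_splitBy] at h2
  refine ⟨(bcMins (abcDecomposition e)).toFinset, ?_, fun t ht => ?_, fun t ht => ?_⟩
  · exact (List.toFinset_card_of_nodup h1).trans (length_bcMins _)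
  · have hc := h2 t (List.mem_toFinset.1 ht)
    rw [List.ofFn_eq_map, List.count, List.countP_map, List.countP_eq_length_filter,
      List.length_eq_one_iff] at hc
    obtain ⟨i, hi⟩ := hc
    have key : ∀ j, e j = t ↔ j = i := fun j => by
      rw [← List.mem_singleton (b := i), ← hi]
      simp
    exact ⟨i, (key i).2 rfl, fun j hj => (key j).1 hj⟩
  · rw [List.mem_toFinset] at ht ⊢
    exact h3 t ht

/-! ### Lower bound for the number of fixed points. -/

theorem two_pow_dvd_of_two_pow_mul_eq_zero {k m : ℕ} {u : ZMod (2 ^ m)} (h : 2 ^ k * u = 0) :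
    2 ^ (m - k) ∣ u := by
  obtain ⟨z, rfl⟩ := ZMod.intCast_surjective u
  have h' : ((2 ^ k * z : ℤ) : ZMod (2 ^ m)) = 0 := by push_cast; exact h
  rw [ZMod.intCast_zmod_eq_zero_iff_dvd] at h'
  push_cast at h'
  have : (2 : ℤ) ^ (m - k) ∣ z := by
    rcases le_total m k with hmk | hmk
    · simp [Nat.sub_eq_zero_of_le hmk]
    · rw [← Nat.add_sub_cancel' hmk, pow_add] at h'
      exact (mul_dvd_mul_iff_left (by positivity)).1 h'
  obtain ⟨w, rfl⟩ := this
  exact ⟨w, by push_cast; rfl⟩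

theorem two_dvd_sub_one_of_two_dvd {m : ℕ} (hm : 1 ≤ m) {u v : ZMod (2 ^ m)}
    (h : 2 ∣ 1 - u * v) : 2 ∣ v - 1 := by
  let f : ZMod (2 ^ m) →+* ZMod 2 := ZMod.castHom (dvd_pow_self 2 (by omega)) _
  have h0 : f 2 = 0 := by rw [map_ofNat]; rfl
  obtain ⟨w, hw⟩ := h
  have h1 := congrArg f hw
  rw [map_sub, map_mul, map_mul, h0, zero_mul, map_one] at h1
  obtain ⟨z, rfl⟩ := ZMod.intCast_surjective v
  rw [map_intCast] at h1
  have h2 : ((z - 1 : ℤ) : ZMod 2) = 0 := by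
    push_cast
    generalize f u = a at h1
    generalize (z : ZMod 2) = b at h1
    revert a b
    decide
  rw [ZMod.intCast_zmod_eq_zero_iff_dvd] at h2
  obtain ⟨y, hy⟩ := h2
  exact ⟨y, by exact_mod_cast congrArg (Int.cast : ℤ → ZMod (2 ^ m)) hy⟩

section Sparse

variable {T : Finset ℕ}

theorem card_filter_le_eq (v : ℕ) :
    (T.filter (· ≤ v)).card = (T.filter (· < v)).card + if v ∈ T then 1 else 0 := by
  have h : T.filter (· ≤ v) = T.filter (· < v) ∪ T.filter (· = v) := by
    ext t; simp only [Finset.mem_filter, Finset.mem_union, le_iff_lt_or_eq]; tauto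
  rw [h, Finset.card_union_of_disjoint]
  · rw [Finset.filter_eq']
    split <;> simp
  · exact Finset.disjoint_filter.2 fun t _ h1 h2 => by omega

/-- For `u < v` the interval `[u, v]` has `v - u + 1` integers, and one of `u`, `u + 1` is missing
from `T`. For `v ≤ u` the subtraction truncates to 0, and the hypothesis excludes `u = v ∈ T`. -/
theorem card_filter_le_le_add (hT : ∀ t ∈ T, t + 1 ∉ T) {u v : ℕ} (h : u ≠ v ∨ v ∉ T) :
    (T.filter (· ≤ v)).card ≤ (T.filter (· < u)).card + (v - u) := by
  rcases le_or_gt v u with huv | huv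
  · refine (Finset.card_le_card fun t ht => ?_).trans (Nat.le_add_right _ _)
    rw [Finset.mem_filter] at ht ⊢
    refine ⟨ht.1, lt_of_le_of_ne (ht.2.trans huv) ?_⟩
    rintro rfl
    obtain rfl : t = v := le_antisymm ht.2 huv
    tauto
  · obtain ⟨w, hw, hwu⟩ : ∃ w ∉ T, w = u ∨ w = u + 1 := by
      by_cases hu : u ∈ T
      · exact ⟨u + 1, hT u hu, .inr rfl⟩
      · exact ⟨u, hu, .inl rfl⟩
    have hsub : T.filter (· ≤ v) ⊆ T.filter (· < u) ∪ (Finset.Icc u v).erase w := fun t ht => by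
      have : t ≠ w := by rintro rfl; exact hw (Finset.mem_filter.1 ht).1
      simp only [Finset.mem_filter, Finset.mem_union, Finset.mem_erase, Finset.mem_Icc] at ht ⊢
      have := lt_or_ge t u
      tauto
    refine (Finset.card_le_card hsub).trans ((Finset.card_union_le _ _).trans ?_)
    rw [Finset.card_erase_of_mem (Finset.mem_Icc.2 (by omega)), Nat.card_Icc]
    omega

end Sparse

section LowerBound

variable {ι : Type*} {e : ι → ℕ}

theorem AddMonoidHom.apply_natCast_eq_sum [Fintype ι] [DecidableEq ι]
    (φ : (∀ i, ZMod (2 ^ e i)) →+ ∀ i, ZMod (2 ^ e i))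
    (m : ι → ℕ) (i : ι) :
    φ (fun j => (m j : ZMod (2 ^ e j))) i = ∑ j, (m j : ZMod (2 ^ e i)) * φ (Pi.single j 1) i := by
  have h : (fun j => (m j : ZMod (2 ^ e j))) =
      ∑ j, m j • (Pi.single j 1 : ∀ i, ZMod (2 ^ e i)) := by
    rw [← Finset.univ_sum_single fun j => (m j : ZMod (2 ^ e j))]
    refine Finset.sum_congr rfl fun j _ => ?_
    rw [← Pi.single_smul]
    simp
  rw [h, map_sum, Finset.sum_apply]
  refine Finset.sum_congr rfl fun j _ => ?_
  rw [map_nsmul, Pi.smul_apply, nsmul_eq_mul]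

/-- The `j`-th generator is killed by `2 ^ e j`, hence so is its image. The bound is vacuous when `e
i ≤ e j`. -/
theorem two_pow_dvd_apply_single [DecidableEq ι]
    (φ : (∀ i, ZMod (2 ^ e i)) →+ ∀ i, ZMod (2 ^ e i)) (i j : ι) :
    2 ^ (e i - e j) ∣ φ (Pi.single j 1) i := by
  refine two_pow_dvd_of_two_pow_mul_eq_zero ?_
  have h : (2 ^ e j) • (Pi.single j 1 : ∀ i, ZMod (2 ^ e i)) = 0 := by
    rw [← Pi.single_smul, nsmul_eq_mul, ZMod.natCast_self, zero_mul, Pi.single_zero]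
  have h' := congrFun (congrArg φ h) i
  rw [map_nsmul, map_zero, Pi.smul_apply, nsmul_eq_mul] at h'
  exact_mod_cast h'

/-- In the `(i, i)` entry of `φ ∘ φ⁻¹ = 1`, every off-diagonal product is even: the entry of `φ` is
even if `e j < e i`, that of `φ⁻¹` if `e j > e i`. So the product of the two diagonal entries is
odd. -/
theorem two_dvd_diagonal_sub_one [Fintype ι] [DecidableEq ι]
    (φ : (∀ i, ZMod (2 ^ e i)) ≃+ ∀ i, ZMod (2 ^ e i)) {i : ι}
    (hi : 1 ≤ e i) (huniq : ∀ j, j ≠ i → e j ≠ e i) : 2 ∣ φ (Pi.single i 1) i - 1 := by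
  -- The coordinates live in different rings, so they are lifted to naturals, keeping evenness where
  -- it will be needed.
  have hm : ∀ j, ∃ m : ℕ, (m : ZMod (2 ^ e j)) = φ.symm (Pi.single i 1) j ∧
      (e i < e j → 2 ∣ m) := fun j => by
    have hd := two_pow_dvd_apply_single φ.symm.toAddMonoidHom j i
    by_cases hij : e i < e j
    · obtain ⟨w, hw⟩ := (dvd_pow_self 2 (by omega)).trans hd
      refine ⟨2 * w.val, ?_, fun _ => dvd_mul_right _ _⟩
      push_cast
      rw [ZMod.natCast_zmod_val]
      exact hw.symm
    · exact ⟨(φ.symm (Pi.single i 1) j).val, ZMod.natCast_zmod_val _, fun h => (hij h).elim⟩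
  choose m hm hm2 using hm
  have h := φ.toAddMonoidHom.apply_natCast_eq_sum m i
  rw [funext hm] at h
  have h1 : φ (φ.symm (Pi.single i 1)) i = 1 := by simp
  change φ (φ.symm (Pi.single i 1)) i = _ at h
  rw [h1, ← Finset.add_sum_erase _ _ (Finset.mem_univ i)] at h
  refine two_dvd_sub_one_of_two_dvd hi (u := (m i : ZMod (2 ^ e i))) ?_
  have h2 : (2 : ZMod (2 ^ e i)) ∣ ∑ j ∈ Finset.univ.erase i,
      (m j : ZMod (2 ^ e i)) * φ.toAddMonoidHom (Pi.single j 1) i := by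
    refine Finset.dvd_sum fun j hj => ?_
    rcases lt_or_gt_of_ne (huniq j (Finset.ne_of_mem_erase hj)) with hji | hji
    · exact Dvd.dvd.mul_left
        ((dvd_pow_self 2 (by omega)).trans (two_pow_dvd_apply_single φ.toAddMonoidHom i j)) _
    · obtain ⟨w, hw⟩ := hm2 j hji
      exact Dvd.dvd.mul_right ⟨(w : ZMod (2 ^ e i)), by rw [hw]; push_cast; rfl⟩ _
  obtain ⟨w, hw⟩ := h2
  exact ⟨w, by rw [← hw]; exact sub_eq_of_eq_add' h⟩

/-- Multiplication of the `i`-th coordinate by `2 ^ c i`. -/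
def twoPowMul (e c : ι → ℕ) : (∀ i, ZMod (2 ^ e i)) →+ ∀ i, ZMod (2 ^ e i) where
  toFun x i := 2 ^ c i * x i
  map_zero' := by ext; simp
  map_add' x y := by ext; simp [mul_add]

theorem card_range_twoPowMul [Fintype ι] {c : ι → ℕ} (hc : ∀ i, c i ≤ e i) :
    2 ^ (∑ i, c i) * Nat.card (twoPowMul e c).range = Nat.card (∀ i, ZMod (2 ^ e i)) := by
  have h : Nat.card (twoPowMul e c).ker = 2 ^ ∑ i, c i := by
    have h1 : Nat.card (twoPowMul e c).ker =
        Nat.card (∀ i, {u : ZMod (2 ^ e i) // ((2 : ℕ) : ZMod (2 ^ e i)) ^ c i * u = 0}) := by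
      refine Nat.card_congr (Equiv.trans ?_ Equiv.subtypePiEquivPi)
      exact Equiv.subtypeEquivRight fun x => by
        simp [AddMonoidHom.mem_ker, twoPowMul, funext_iff]
    rw [h1, Nat.card_pi, ← Finset.prod_pow_eq_pow_sum]
    exact Finset.prod_congr rfl fun i _ => card_pow_mul_eq_zero Nat.prime_two (hc i)
  rw [← h, ← AddSubgroup.index_ker, AddSubgroup.card_mul_index]

theorem two_pow_card_le_card_fixed [Fintype ι] [DecidableEq ι]
    (φ : (∀ i, ZMod (2 ^ e i)) ≃+ ∀ i, ZMod (2 ^ e i))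
    (he : ∀ i, 1 ≤ e i) {T : Finset ℕ} (hT : ∀ t ∈ T, ∃! i, e i = t)
    (hT' : ∀ t ∈ T, t + 1 ∉ T) : 2 ^ T.card ≤ Nat.card {x // φ x = x} := by
  set a : ι → ℕ := fun i => (T.filter (· < e i)).card with ha
  set b : ι → ℕ := fun i => (T.filter (· ≤ e i)).card with hb
  -- `b i - a i` is 1 exactly when `e i ∈ T`, and each element of `T` is attained by one index.
  have hab : ∑ i, b i = ∑ i, a i + T.card := by
    simp only [hb, card_filter_le_eq, Finset.sum_add_distrib, ha]
    congr 1
    rw [Finset.sum_boole, Nat.cast_id]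
    refine Finset.card_bij (fun i _ => e i) (fun i hi => (Finset.mem_filter.1 hi).2)
      (fun i hi j _ hij => (hT _ (Finset.mem_filter.1 hi).2).unique rfl hij.symm) fun t ht => ?_
    obtain ⟨i, rfl, -⟩ := hT t ht
    exact ⟨i, by simpa using ht, rfl⟩
  have hbe : ∀ i, b i ≤ e i := fun i => by
    have : T.filter (· ≤ e i) ⊆ Finset.Icc 1 (e i) := fun t ht => by
      rw [Finset.mem_filter] at ht
      obtain ⟨j, rfl, -⟩ := hT t ht.1
      exact Finset.mem_Icc.2 ⟨he j, ht.2⟩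
    simpa using Finset.card_le_card this
  have hae : ∀ i, a i ≤ e i := fun i => by
    have : b i = a i + _ := card_filter_le_eq (e i)
    have := hbe i
    omega
  set f := φ.toAddMonoidHom - AddMonoidHom.id _ with hf
  have hmaps : ∀ x ∈ (twoPowMul e a).range, f x ∈ (twoPowMul e b).range := by
    rintro _ ⟨y, rfl⟩
    have hx : twoPowMul e a y = fun j => ((2 ^ a j * (y j).val : ℕ) : ZMod (2 ^ e j)) := by
      ext j
      simp [twoPowMul]
    have hdvd : ∀ i, 2 ^ b i ∣ f (twoPowMul e a y) i := fun i => by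
      have hi : f (twoPowMul e a y) i = φ.toAddMonoidHom (twoPowMul e a y) i -
        twoPowMul e a y i := rfl
      have hoff : ∀ j, j ≠ i ∨ e i ∉ T → (2 : ZMod (2 ^ e i)) ^ b i ∣
          ((2 ^ a j * (y j).val : ℕ) : ZMod (2 ^ e i)) * φ.toAddMonoidHom (Pi.single j 1) i := by
        intro j hj
        have hle : b i ≤ a j + (e i - e j) := card_filter_le_le_add hT' <| by
          rw [or_iff_not_imp_right, not_not]
          intro hiT hij
          exact (hj.resolve_right (not_not.2 hiT)) ((hT _ hiT).unique hij rfl)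
        refine (pow_dvd_pow 2 hle).trans ?_
        rw [pow_add]
        refine mul_dvd_mul ?_ (two_pow_dvd_apply_single _ i j)
        push_cast
        exact dvd_mul_right _ _
      rw [hi, hx, AddMonoidHom.apply_natCast_eq_sum]
      -- If `e i ∈ T`, the extra factor 2 comes from the even entry `φ i i - 1`; otherwise `b i = a
      -- i` and the diagonal needs no extra factor.
      by_cases hiT : e i ∈ T
      · rw [← Finset.add_sum_erase _ _ (Finset.mem_univ i), add_sub_right_comm]
        refine dvd_add ?_ (Finset.dvd_sum fun j hj => hoff j (.inl (Finset.ne_of_mem_erase hj)))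
        have hbi : b i = a i + 1 := by simp only [hb, ha, card_filter_le_eq, if_pos hiT]
        rw [← mul_sub_one, hbi, pow_succ]
        refine mul_dvd_mul ?_ (two_dvd_diagonal_sub_one φ (he i) fun j hj hij =>
          hj ((hT _ hiT).unique hij rfl))
        push_cast
        exact dvd_mul_right _ _
      · refine dvd_sub (Finset.dvd_sum fun j _ => hoff j (.inr hiT)) ?_
        have hbi : b i = a i := by simp only [hb, ha, card_filter_le_eq, if_neg hiT, add_zero]
        rw [hbi]
        push_cast
        exact dvd_mul_right _ _
    choose z hz using hdvd
    exact ⟨z, funext fun i => (hz i).symm⟩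
  have hfix : Nat.card f.ker = Nat.card {x // φ x = x} :=
    Nat.card_congr (Equiv.subtypeEquivRight fun x => by
      rw [AddMonoidHom.mem_ker]; exact sub_eq_zero)
  -- Restricted to the larger subgroup, `φ - 1` lands in one smaller by the factor `2 ^ #T`, which
  -- forces the kernel to be at least that large.
  set r := f.comp (twoPowMul e a).range.subtype with hr
  have h1 : Nat.card r.ker * Nat.card r.range = Nat.card (twoPowMul e a).range := by
    rw [← AddSubgroup.index_ker, AddSubgroup.card_mul_index]
  have h2 : Nat.card r.range ≤ Nat.card (twoPowMul e b).range := by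
    refine AddSubgroup.card_le_of_le ?_
    rintro _ ⟨x, rfl⟩
    exact hmaps x.1 x.2
  have h3 : Nat.card r.ker ≤ Nat.card {x // φ x = x} := by
    rw [← hfix]
    refine Nat.card_le_card_of_injective (fun x => (⟨x.1.1, x.2⟩ : f.ker)) fun x y hxy => ?_
    exact Subtype.ext (Subtype.ext (congrArg (fun z : f.ker => z.1) hxy))
  have h4 := card_range_twoPowMul hae
  have h5 := card_range_twoPowMul hbe
  have hpos : 0 < Nat.card (twoPowMul e b).range := Nat.card_pos
  rw [← h4, hab, pow_add, mul_assoc] at h5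
  have h6 := Nat.eq_of_mul_eq_mul_left (by positivity) h5
  refine Nat.le_of_mul_le_mul_right ?_ hpos
  rw [h6, ← h1]
  exact Nat.mul_le_mul h3 h2

end LowerBound

theorem two_pow_numBlocks_dvd_card_fixed {n : ℕ} {e : Fin n → ℕ} (hmono : Monotone e)
    (he : ∀ i, 1 ≤ e i) (φ : (∀ i, ZMod (2 ^ e i)) ≃+ ∀ i, ZMod (2 ^ e i)) :
    2 ^ (numBBlocks e + numCBlocks e) ∣ Nat.card {x // φ x = x} := by
  obtain ⟨T, hcard, hT, hT'⟩ := exists_sparse_values e hmono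
  have h := two_pow_card_le_card_fixed φ he hT hT'
  -- The count divides a power of 2, so it is itself one and the inequality becomes divisibility.
  have hdvd : Nat.card {x // φ x = x} ∣ Nat.card (∀ i, ZMod (2 ^ e i)) :=
    (φ.toAddMonoidHom.eqLocus (AddMonoidHom.id _)).card_addSubgroup_dvd_card
  have hP : Nat.card (∀ i, ZMod (2 ^ e i)) = 2 ^ ∑ i, e i := by
    rw [Nat.card_pi, ← Finset.prod_pow_eq_pow_sum]
    simp
  rw [hP, Nat.dvd_prime_pow Nat.prime_two] at hdvd
  obtain ⟨m, -, hm⟩ := hdvd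
  rw [hm] at h ⊢
  rw [← hcard]
  exact pow_dvd_pow 2 ((Nat.pow_le_pow_iff_right (by norm_num)).1 h)

/-! ### The Reidemeister spectrum. -/

theorem mainTheorem1 {A : Type*} [CommGroup A] [Finite A] {n : ℕ} (e : Fin n → ℕ)
    (S : Sylow 2 A) (hS : IsOfType 2 e S) :
    reidemeisterSpectrum A =
      ((↑) : ℕ → ℕ∞) ''
        {d : ℕ | d ∣ Nat.card A ∧ numBBlocks e + numCBlocks e ≤ padicValNat 2 d} := by
  obtain ⟨hmono, he, ⟨g⟩⟩ := hS
  let g' : Additive S ≃+ ∀ i, ZMod (2 ^ e i) := MulEquiv.toAdditiveLeft g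
  rw [reidemeisterSpectrum_eq]
  congr 1
  ext d
  constructor
  · rintro ⟨φ, rfl⟩
    let ψ : A ≃* A := MulEquiv.toAdditive.symm φ
    let F : Subgroup A := ψ.toMonoidHom.eqLocus (MonoidHom.id A)
    have hF : Nat.card {x // φ x = x} = Nat.card F := rfl
    -- The Sylow subgroup is normal, hence characteristic, so `ψ` restricts to it and the lower
    -- bound applies to its fixed points in `S`.
    have hmap : (S : Subgroup A).map ψ.toMonoidHom = S :=
      Subgroup.characteristic_iff_map_eq.1 (S.characteristic_of_normal inferInstance) ψ
    let χ : S ≃* S := (ψ.subgroupMap (S : Subgroup A)).trans (MulEquiv.subgroupCongr hmap)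
    have h := two_pow_numBlocks_dvd_card_fixed hmono he
      ((g'.symm.trans (MulEquiv.toAdditive χ)).trans g')
    have hS : Nat.card {x // ((g'.symm.trans (MulEquiv.toAdditive χ)).trans g') x = x} =
        Nat.card (F ⊓ S : Subgroup A) := by
      refine Nat.card_congr (Equiv.trans (g'.symm.toEquiv.subtypeEquiv
        (q := fun y : Additive S => ψ (y.toMul : A) = (y.toMul : A)) fun x => ?_)
        { toFun := fun y => ⟨y.1.toMul, y.2, y.1.toMul.2⟩
          invFun := fun y => ⟨Additive.ofMul ⟨y.1, y.2.2⟩, y.2.1⟩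
          left_inv := fun y => rfl
          right_inv := fun y => rfl })
      change g' (MulEquiv.toAdditive χ (g'.symm x)) = x ↔ _
      rw [← g'.eq_symm_apply]
      exact Subtype.ext_iff
    rw [hS] at h
    refine ⟨hF ▸ F.card_subgroup_dvd_card, ?_⟩
    rw [hF]
    exact (padicValNat_dvd_iff_le Nat.card_pos.ne').1
      (h.trans (Subgroup.card_dvd_of_le inf_le_left))
  · rintro ⟨hd, hval⟩
    -- Schur–Zassenhaus splits off the odd part; `d` splits accordingly, and the factor dividing
    -- `Nat.card S` carries the whole 2-adic valuation.
    obtain ⟨K, hK⟩ := Subgroup.exists_right_complement'_of_coprime (N := (S : Subgroup A))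
      S.card_coprime_index
    let s : S × K ≃* A := MulEquiv.ofBijective
      (MonoidHom.coprod (S : Subgroup A).subtype K.subtype) hK
    let s' : Additive S × Additive K ≃+ Additive A :=
      { s with map_add' := fun x y => s.map_mul x y }
    have hcardS : Nat.card S = 2 ^ ∑ i, e i := by
      rw [← Finset.prod_pow_eq_pow_sum]
      refine (Nat.card_congr g'.toEquiv).trans ?_
      rw [Nat.card_pi]
      simp
    have hodd : Odd (Nat.card K) := by
      rw [← hK.symm.index_eq_card, ← Nat.not_even_iff_odd, even_iff_two_dvd]
      exact S.not_dvd_index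
    rw [← hK.card_mul_card] at hd
    obtain ⟨d₁, d₂, hd₁, hd₂, rfl⟩ := exists_dvd_and_dvd_of_dvd_mul hd
    change d₁ ∣ Nat.card S at hd₁
    rw [hcardS, Nat.dvd_prime_pow Nat.prime_two] at hd₁
    obtain ⟨m, hm, rfl⟩ := hd₁
    have hd₂odd : ¬ 2 ∣ d₂ := fun h =>
      Nat.not_even_iff_odd.2 hodd (even_iff_two_dvd.2 (h.trans hd₂))
    have hd₂0 : d₂ ≠ 0 := fun h => hd₂odd (h ▸ dvd_zero 2)
    rw [padicValNat.mul (by positivity) hd₂0, padicValNat.prime_pow,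
      padicValNat.eq_zero_of_not_dvd hd₂odd, add_zero] at hval
    exact (((hasFixTwoPowers_pi e he m hval hm).congr g'.symm).prod
      (hasFixCard_of_odd (Additive K) hodd hd₂)).congr s'
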